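/- Let $f:\mathbb{R}\to[0,\infty]$ be proper (i.e. $\operatorname{dom} f=\{x: f(x)<\infty\}\neq\emptyset$), lower semicontinuous and convex. Assume that $f$ is essentially smooth: $\operatorname{int}(\operatorname{dom} f)\ne\emptyset$, $f$ is differentiable on $\operatorname{int}(\operatorname{dom} f)$, and $|f'(x^k)|\to\infty$ whenever $x^k\in\operatorname{int}(\operatorname{dom} f)$ converges to a boundary point of $\operatorname{dom} f$. Assume moreover that there is a finite set $W\subset\operatorname{int}(\operatorname{dom} f)$ such that $f$ is strongly convex on every compact convex subset of $\operatorname{int}(\operatorname{dom} f)\setminus W$ and $f'$ is locally Lipschitz continuous on every convex subset of $\operatorname{int}(\operatorname{dom} f)\setminus W$. Let $f_\infty(d)=\sup_{t>0}\frac{f(y+td)-f(y)}{t}$ be the recession function of $f$ (independent of the choice of $y\in\operatorname{dom} f$), and let $f^\pi(x,t)$ be the closed perspective function of $f$, equal to $t f(x/t)$ if $t>0$, to $f_\infty(x)$ if $t=0$, and to $\infty$ if $t<0$. Equip $\mathbb{R}^3$ with the standard inner product and the Euclidean norm and distance $\mathrm{d}$. Let $$K=\operatorname{epi} f^\pi=\{(x,t,r)\in\mathbb{R}^3: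 r\ge f^\pi(x,t)\},\qquad K^*=\{z\in\mathbb{R}^3:\langle z,y\rangle\ge 0\ \text{ for all } y\in K\}.$$ Then, for every real $s>1$, there is a set $A$ with $\mathcal{H}^s(A)=0$, where $\mathcal{H}^s$ is the $s$-dimensional Hausdorff measure on $\mathbb{R}^3$, such that for every $z^*$ in the boundary of $K^*$ with $z^*\notin A$, the pair $K,z^*$ admits a one-step facial residual function that is Hölderian of exponent $1/2$. That is, there are nondecreasing functions $\rho_1,\rho_2:[0,\infty)\to[0,\infty)$ such that $\psi(\epsilon,t)=\rho_1(t)\,\epsilon+\rho_2(t)\,\epsilon^{1/2}$ is nonnegative, is nondecreasing in each argument, satisfies $\psi(0,t)=0$ for all $t\ge0$, and has the following property: for every $x\in\operatorname{span}(K)$ and every $\epsilon\ge0$, $$\mathrm{d}(x,K)\le\epsilon\ \text{ and }\ \langle x,z^*\rangle\le\epsilon\quad\Longrightarrow\quad \mathrm{d}\bigl(x,K\cap\{z^*\}^\perp\bigr)\le\psi(\epsilon,\|x\|).$$ -/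

import Mathlib

open Set Filter Topology MeasureTheory
open scoped NNReal

noncomputable section

namespace PerspectiveCone

/-- The effective domain `dom h` of an extended-real-valued function. -/
def dom (h : ℝ → EReal) : Set ℝ := {x | h x < ⊤}

/-- The epigraph `epi h ⊆ ℝ × ℝ`. -/
def epi (h : ℝ → EReal) : Set (ℝ × ℝ) := {p | h p.1 ≤ (p.2 : EReal)}

/-- The real-valued function agreeing with `h` wherever `h` is finite; it is only used at interior
points of `dom h`. -/
def realPart (h : ℝ → EReal) (x : ℝ) : ℝ := (h x).toReal

/-- Properness: `h` never takes the value `-∞` and is finite somewhere. -/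
def IsProper (h : ℝ → EReal) : Prop := (∀ x, h x ≠ ⊥) ∧ (dom h).Nonempty

/-- Essential smoothness: `int (dom h)` is nonempty, `h` is differentiable there, and `|h'(xₖ)| → ∞`
whenever `xₖ ∈ int (dom h)` converges to a boundary point of `dom h`. -/
structure IsEssentiallySmooth (h : ℝ → EReal) : Prop where
  nonempty_interior : (interior (dom h)).Nonempty
  differentiableOn : DifferentiableOn ℝ (realPart h) (interior (dom h))
  tendsto_abs_deriv : ∀ (u : ℕ → ℝ) (x : ℝ), (∀ k, u k ∈ interior (dom h)) →
    x ∈ frontier (dom h) → Tendsto u atTop (𝓝 x) →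
    Tendsto (fun k => |deriv (realPart h) (u k)|) atTop atTop

/-- The standing assumption: `f : ℝ → ℝ₊ ∪ {∞}` is nonnegative, proper, closed, convex and
essentially smooth, and away from some finite set `W ⊆ int (dom f)` it is strongly convex on compact
convex sets and its derivative is locally Lipschitz on convex sets. -/
structure StandingAssumption (f : ℝ → EReal) : Prop where
  nonneg : ∀ x, 0 ≤ f x
  proper : IsProper f
  closed : LowerSemicontinuous f
  convex : Convex ℝ (epi f)
  essentiallySmooth : IsEssentiallySmooth f
  exists_finite : ∃ W : Set ℝ, W.Finite ∧ W ⊆ interior (dom f) ∧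
    (∀ C : Set ℝ, IsCompact C → Convex ℝ C → C ⊆ interior (dom f) \ W →
      ∃ m : ℝ, 0 < m ∧ StrongConvexOn C m (realPart f)) ∧
    (∀ C : Set ℝ, Convex ℝ C → C ⊆ interior (dom f) \ W →
      LocallyLipschitzOn C (deriv (realPart f)))

/-- The recession function `h_∞(d) = sup_{t > 0} (h (y + t d) - h y) / t`, where `y ∈ dom h`. For a
proper closed convex `h` the supremum over `t` does not depend on `y`, so that it may be taken over
all `y ∈ dom h`. -/
def recession (h : ℝ → EReal) (d : ℝ) : EReal :=
  ⨆ y ∈ dom h, ⨆ t : ℝ, ⨆ _ : 0 < t, (h (y + t * d) - h y) / (t : EReal)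

/-- The closed perspective function `h^π(x, t)`: `t h(x/t)` for `t > 0`, `h_∞(x)` for `t = 0`, and
`∞` for `t < 0`. -/
def perspective (h : ℝ → EReal) (x t : ℝ) : EReal :=
  if 0 < t then (t : EReal) * h (x / t) else if t = 0 then recession h x else ⊤

/-- The perspective cone `epi h^π = {(x, t, r) : h^π(x, t) ≤ r}` in Euclidean space `ℝ³`. -/
def perspectiveCone (h : ℝ → EReal) : Set (EuclideanSpace ℝ (Fin 3)) :=
  {v | perspective h (v 0) (v 1) ≤ ((v 2 : ℝ) : EReal)}

/-- The dual cone `K* = {x : ⟪x, y⟫ ≥ 0 for all y ∈ K}`. -/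
def dualCone {E : Type*} [NormedAddCommGroup E] [InnerProductSpace ℝ E] [CompleteSpace E]
    (K : Set E) : Set E :=
  (ProperCone.innerDual K : Set E)

/-- The subset `K ∩ {z}^⊥` of `K`. -/
def exposedFace {E : Type*} [NormedAddCommGroup E] [InnerProductSpace ℝ E] (K : Set E) (z : E) :
    Set E :=
  K ∩ {y | inner ℝ y z = 0}

/-- `ψ` is a one-step facial residual function for the closed convex cone `K` and `z ∈ K*`. -/
structure IsOneFRF {E : Type*} [NormedAddCommGroup E] [InnerProductSpace ℝ E] (K : Set E) (z : E)
    (ψ : ℝ≥0 → ℝ≥0 → ℝ≥0) : Prop where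
  monotone_left : ∀ t, Monotone fun ε => ψ ε t
  monotone_right : ∀ ε, Monotone fun t => ψ ε t
  zero_left : ∀ t, ψ 0 t = 0
  infDist_le : ∀ x ∈ Submodule.span ℝ K, ∀ ε : ℝ≥0,
    Metric.infDist x K ≤ ε → inner ℝ x z ≤ (ε : ℝ) →
      Metric.infDist x (exposedFace K z) ≤ ψ ε ‖x‖₊

/-- The pair `K, z` admits a one-step facial residual function that is Hölderian of exponent `α`,
that is, one of the form `ψ(ε, t) = ρ₁(t) ε + ρ₂(t) ε^α` with `ρ₁, ρ₂ : ℝ₊ → ℝ₊` nondecreasing. -/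
def AdmitsHolderianOneFRF {E : Type*} [NormedAddCommGroup E] [InnerProductSpace ℝ E] (K : Set E)
    (z : E) (α : ℝ) : Prop :=
  ∃ ρ₁ ρ₂ : ℝ≥0 → ℝ≥0, Monotone ρ₁ ∧ Monotone ρ₂ ∧
    IsOneFRF K z fun ε t => ρ₁ t * ε + ρ₂ t * ε ^ α

end PerspectiveCone

end

namespace PerspectiveCone

variable {f : ℝ → EReal}

/-! ### Membership in the cone, in real terms -/

namespace StandingAssumption

/-! The dual cone K* is closed, so its boundary lies in it, and the bound is proved for every z in
K* off finitely many lines through 0. A line has dimension 1, hence is `μH[s]`-null for s > 1.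

It suffices to bound, for y in K, the distance to the face by a multiple of ⟪y, z⟫ plus a multiple
of √(‖y‖⟪y, z⟫) (`admitsHolderianOneFRF_of_bound`). In each case an explicit point of the face
realises this bound.

If z 2 = 0, then z 0 * w + z 1 ≥ 0 on dom f. Off the exceptional lines this is bounded away from 0
on dom f, and the bound towards the vertical ray is linear (`admits_of_vertical`).

If z 2 > 0, then z is a multiple of (-v, β, 1) with β ≥ f*(v). When β > f*(v), the gap controls y 1,
and the recession behaviour of f - v in the direction of y 0 controls the rest: again a linear bound
(`admits_of_conjugate_lt`). When β = f*(v), at most one v per direction has recession slope v, and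
these are discarded. For any other v, f - v is coercive both ways, so essential smoothness and
Darboux's theorem give f'(u) = v at an interior u. Discarding also f'(W), f is strongly convex near
u, and quadratic growth yields the square root (`exists_growth`, `admits_of_tangent`). -/

theorem coe_realPart (hf : StandingAssumption f) {w : ℝ} (hw : w ∈ dom f) :
    ((realPart f w : ℝ) : EReal) = f w :=
  EReal.coe_toReal (ne_of_lt hw) (hf.proper.1 w)

theorem realPart_nonneg (hf : StandingAssumption f) (w : ℝ) : 0 ≤ realPart f w :=
  EReal.toReal_nonneg (hf.nonneg w)

theorem le_coe_iff (hf : StandingAssumption f) (w r : ℝ) :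
    f w ≤ (r : EReal) ↔ w ∈ dom f ∧ realPart f w ≤ r := by
  constructor
  · intro h
    have hw : w ∈ dom f := lt_of_le_of_lt h (EReal.coe_lt_top r)
    refine ⟨hw, ?_⟩
    rw [← hf.coe_realPart hw] at h
    exact_mod_cast h
  · rintro ⟨hw, h⟩
    rw [← hf.coe_realPart hw]
    exact_mod_cast h

theorem convexOn (hf : StandingAssumption f) : ConvexOn ℝ (dom f) (realPart f) := by
  have key : ∀ x ∈ dom f, ∀ y ∈ dom f, ∀ a b : ℝ, 0 ≤ a → 0 ≤ b → a + b = 1 →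
      f (a • x + b • y) ≤ ((a • realPart f x + b • realPart f y : ℝ) : EReal) := by
    intro x hx y hy a b ha hb hab
    have h1 : ((x, realPart f x) : ℝ × ℝ) ∈ epi f := (hf.coe_realPart hx).ge
    have h2 : ((y, realPart f y) : ℝ × ℝ) ∈ epi f := (hf.coe_realPart hy).ge
    exact hf.convex h1 h2 ha hb hab
  refine ⟨fun x hx y hy a b ha hb hab => ?_, fun x hx y hy a b ha hb hab => ?_⟩
  · exact ((hf.le_coe_iff _ _).1 (key x hx y hy a b ha hb hab)).1
  · exact ((hf.le_coe_iff _ _).1 (key x hx y hy a b ha hb hab)).2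

theorem recession_le_iff (hf : StandingAssumption f) (x r : ℝ) :
    recession f x ≤ (r : EReal) ↔
      ∀ w ∈ dom f, ∀ t : ℝ, 0 < t →
        w + t * x ∈ dom f ∧ realPart f (w + t * x) ≤ realPart f w + t * r := by
  simp only [recession, iSup_le_iff]
  refine forall_congr' fun w => forall_congr' fun hw => forall_congr' fun t =>
    forall_congr' fun ht => ?_
  rw [← hf.le_coe_iff, EReal.div_le_iff_le_mul (by exact_mod_cast ht) (EReal.coe_ne_top t),
    ← hf.coe_realPart hw, EReal.sub_le_iff_le_add (Or.inl (EReal.coe_ne_bot _))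
      (Or.inl (EReal.coe_ne_top _))]
  rw [show ((t : EReal) * r + (realPart f w : ℝ)) = ((realPart f w + t * r : ℝ) : EReal) by
    push_cast; rw [add_comm]]

theorem mem_of_pos (hf : StandingAssumption f) {y : EuclideanSpace ℝ (Fin 3)} (ht : 0 < y 1) :
    y ∈ perspectiveCone f ↔ y 0 / y 1 ∈ dom f ∧ y 1 * realPart f (y 0 / y 1) ≤ y 2 := by
  simp only [perspectiveCone, perspective, Set.mem_ofPred_eq, if_pos ht]
  rw [mul_comm (y 1 : EReal), ← EReal.le_div_iff_mul_le (EReal.coe_pos.2 ht) (EReal.coe_ne_top _),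
    ← EReal.coe_div, hf.le_coe_iff, le_div_iff₀ ht, mul_comm]

theorem mem_of_eq_zero (hf : StandingAssumption f) {y : EuclideanSpace ℝ (Fin 3)}
    (ht : y 1 = 0) :
    y ∈ perspectiveCone f ↔ ∀ w ∈ dom f, ∀ t : ℝ, 0 < t →
      w + t * y 0 ∈ dom f ∧ realPart f (w + t * y 0) ≤ realPart f w + t * y 2 := by
  rw [← hf.recession_le_iff]
  simp [perspectiveCone, perspective, ht]

end StandingAssumption

theorem nonneg_of_mem {y : EuclideanSpace ℝ (Fin 3)} (hy : y ∈ perspectiveCone f) : 0 ≤ y 1 := by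
  by_contra h
  have h1 : ¬ 0 < y 1 := fun h' => h h'.le
  have h2 : ¬ y 1 = 0 := fun h' => h h'.ge
  simp [perspectiveCone, perspective, h1, h2] at hy

namespace StandingAssumption

/-- Every affine minorant of `f` gives a linear inequality valid on the perspective cone. -/
theorem le_of_affine_le (hf : StandingAssumption f) {p q : ℝ}
    (h : ∀ w ∈ dom f, p * w - q ≤ realPart f w) {y : EuclideanSpace ℝ (Fin 3)}
    (hy : y ∈ perspectiveCone f) : p * y 0 - q * y 1 ≤ y 2 := by
  rcases (nonneg_of_mem hy).eq_or_lt with ht | ht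
  · obtain ⟨w, hw⟩ := hf.proper.2
    have hy' := (hf.mem_of_eq_zero ht.symm).1 hy w hw
    by_contra! hlt
    rw [← ht, mul_zero, sub_zero] at hlt
    set A := realPart f w - p * w + q
    have hA : 0 ≤ A := by have := h w hw; simp only [A]; linarith
    have hd : 0 < p * y 0 - y 2 := by linarith
    -- Along the ray the minorant and the recession inequality force t * (p * y 0 - y 2) ≤ A; this t
    -- makes the left side A + 1.
    have ht0 : 0 < (A + 1) / (p * y 0 - y 2) := by positivity
    obtain ⟨h1, h2⟩ := hy' _ ht0
    have h3 := h _ h1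
    have h4 : (A + 1) / (p * y 0 - y 2) * (p * y 0 - y 2) = A + 1 := div_mul_cancel₀ _ hd.ne'
    simp only [A] at h4 h2 h3
    linarith
  · obtain ⟨h1, h2⟩ := (hf.mem_of_pos ht).1 hy
    have h3 := mul_le_mul_of_nonneg_left (h _ h1) ht.le
    have h4 : y 1 * (p * (y 0 / y 1) - q) = p * y 0 - q * y 1 := by field_simp
    linarith

theorem mem_vertical (hf : StandingAssumption f) {r : ℝ} (hr : 0 ≤ r) :
    !₂[0, 0, r] ∈ perspectiveCone f := by
  rw [hf.mem_of_eq_zero (by simp)]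
  intro w hw t ht
  have := mul_nonneg ht.le hr
  simpa [hw] using this

theorem mem_of_dom (hf : StandingAssumption f) {u t : ℝ} (hu : u ∈ dom f) (ht : 0 ≤ t) :
    !₂[t * u, t, t * realPart f u] ∈ perspectiveCone f := by
  rcases ht.eq_or_lt with rfl | ht
  · simpa using hf.mem_vertical le_rfl
  · rw [hf.mem_of_pos (by simpa using ht)]
    simp [mul_div_cancel_left₀ _ ht.ne', hu]

theorem nonempty_perspectiveCone (hf : StandingAssumption f) : (perspectiveCone f).Nonempty :=
  ⟨_, hf.mem_vertical le_rfl⟩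

end StandingAssumption

/-! ### Reduction to an error bound on the cone -/

theorem inner_eq (y z : EuclideanSpace ℝ (Fin 3)) :
    inner ℝ y z = y 0 * z 0 + y 1 * z 1 + y 2 * z 2 := by
  simp [PiLp.inner_apply, Fin.sum_univ_three, mul_comm]

theorem dist_le_sum (y p : EuclideanSpace ℝ (Fin 3)) :
    dist y p ≤ |y 0 - p 0| + |y 1 - p 1| + |y 2 - p 2| := by
  rw [EuclideanSpace.dist_eq, Fin.sum_univ_three]
  simp only [Real.dist_eq]
  apply Real.sqrt_le_iff.2
  have h0 := abs_nonneg (y 0 - p 0)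
  have h1 := abs_nonneg (y 1 - p 1)
  have h2 := abs_nonneg (y 2 - p 2)
  exact ⟨by positivity, by nlinarith [mul_nonneg h0 h1, mul_nonneg h0 h2, mul_nonneg h1 h2]⟩

theorem mem_dualCone_iff {K : Set (EuclideanSpace ℝ (Fin 3))} {z : EuclideanSpace ℝ (Fin 3)} :
    z ∈ dualCone K ↔ ∀ y ∈ K, 0 ≤ inner ℝ y z := by
  simp [dualCone, ProperCone.mem_innerDual]

theorem isClosed_dualCone (K : Set (EuclideanSpace ℝ (Fin 3))) : IsClosed (dualCone K) :=
  (ProperCone.innerDual K).isClosed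

theorem sqrt_add_le {a b : ℝ} (ha : 0 ≤ a) (hb : 0 ≤ b) : √(a + b) ≤ √a + √b := by
  refine Real.sqrt_le_iff.2 ⟨by positivity, ?_⟩
  nlinarith [Real.sq_sqrt ha, Real.sq_sqrt hb, Real.sqrt_nonneg a, Real.sqrt_nonneg b,
    mul_nonneg (Real.sqrt_nonneg a) (Real.sqrt_nonneg b)]

/-- An error bound on the cone itself yields a Hölderian one-step facial residual function. -/
theorem admitsHolderianOneFRF_of_bound {E : Type*} [NormedAddCommGroup E] [InnerProductSpace ℝ E]
    {K : Set E} (hK : K.Nonempty) {z : E} {C₀ C₁ : ℝ} (h₀ : 0 ≤ C₀) (h₁ : 0 ≤ C₁)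
    (h : ∀ y ∈ K, Metric.infDist y (exposedFace K z) ≤
      C₀ * inner ℝ y z + C₁ * √(‖y‖ * inner ℝ y z)) :
    AdmitsHolderianOneFRF K z (1 / 2) := by
  set Z := ‖z‖
  have hZ : 0 ≤ Z := norm_nonneg z
  set R₁ : ℝ := 1 + C₀ * (1 + Z) + C₁ * √(1 + Z)
  have hR₁ : 0 ≤ R₁ := by positivity
  refine ⟨fun _ => R₁.toNNReal, fun t => (C₁ * √((1 + Z) * t)).toNNReal, monotone_const,
    fun s t hst => Real.toNNReal_le_toNNReal (by gcongr), ?_⟩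
  have hmono : Monotone fun t : ℝ≥0 => (C₁ * √((1 + Z) * t)).toNNReal :=
    fun s t hst => Real.toNNReal_le_toNNReal (by gcongr)
  refine ⟨fun t ε δ hεδ => ?_, fun ε s t hst => ?_, fun t => ?_, fun x _ ε hx hxz => ?_⟩
  · dsimp only; gcongr
  · have := hmono hst
    dsimp only at this ⊢; gcongr
  · simp
  · have key : ∀ η : ℝ, 0 < η → Metric.infDist x (exposedFace K z) ≤
        (ε + η) + C₀ * (ε + (ε + η) * Z) +
          C₁ * √((‖x‖ + (ε + η)) * (ε + (ε + η) * Z)) := by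
      intro η hη
      obtain ⟨y, hy, hxy⟩ := (Metric.infDist_lt_iff hK).1 (lt_of_le_of_lt hx (by linarith :
        (ε : ℝ) < ε + η))
      have hP : inner ℝ y z ≤ ε + (ε + η) * Z := by
        have h1 : inner ℝ y z = inner ℝ x z + inner ℝ (y - x) z := by
          rw [← inner_add_left]; simp
        have h2 : inner ℝ (y - x) z ≤ ‖y - x‖ * ‖z‖ := real_inner_le_norm _ _
        have h3 : ‖y - x‖ ≤ ε + η := by rw [← dist_eq_norm, dist_comm]; exact hxy.le
        have h4 := mul_le_mul_of_nonneg_right h3 hZ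
        linarith
      have hny : ‖y‖ ≤ ‖x‖ + (ε + η) := by
        have h3 : ‖y - x‖ ≤ ε + η := by rw [← dist_eq_norm, dist_comm]; exact hxy.le
        have := norm_le_norm_add_norm_sub x y
        rw [norm_sub_rev] at h3
        linarith
      have hpos : 0 ≤ (ε : ℝ) + (ε + η) * Z := by positivity
      calc Metric.infDist x (exposedFace K z)
          ≤ Metric.infDist y (exposedFace K z) + dist x y := Metric.infDist_le_infDist_add_dist
        _ ≤ (C₀ * inner ℝ y z + C₁ * √(‖y‖ * inner ℝ y z)) + (ε + η) :=
          add_le_add (h y hy) hxy.le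
        _ ≤ (C₀ * (ε + (ε + η) * Z) +
            C₁ * √((‖x‖ + (ε + η)) * (ε + (ε + η) * Z))) + (ε + η) := by
          have : ‖y‖ * inner ℝ y z ≤ (‖x‖ + (ε + η)) * (ε + (ε + η) * Z) :=
            (mul_le_mul_of_nonneg_left hP (norm_nonneg y)).trans
              (mul_le_mul_of_nonneg_right hny hpos)
          gcongr
        _ = _ := by ring
    have hlim : Tendsto (fun η : ℝ => (ε + η) + C₀ * (ε + (ε + η) * Z) +
        C₁ * √((‖x‖ + (ε + η)) * (ε + (ε + η) * Z))) (𝓝[>] 0)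
        (𝓝 ((ε + 0) + C₀ * (ε + (ε + 0) * Z) +
          C₁ * √((‖x‖ + (ε + 0)) * (ε + (ε + 0) * Z)))) :=
      (Continuous.tendsto (by fun_prop) 0).mono_left nhdsWithin_le_nhds
    have hle := ge_of_tendsto hlim (eventually_mem_nhdsWithin.mono key)
    refine hle.trans ?_
    have hsq : √((‖x‖ + (ε + 0)) * (ε + (ε + 0) * Z)) ≤
        √((1 + Z) * ‖x‖) * √ε + √(1 + Z) * ε := by
      have e1 : (‖x‖ + ((ε : ℝ) + 0)) * (ε + (ε + 0) * Z) =
          (1 + Z) * ‖x‖ * ε + (1 + Z) * (ε * ε) := by ring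
      rw [e1]
      refine (sqrt_add_le (by positivity) (by positivity)).trans (le_of_eq ?_)
      rw [Real.sqrt_mul (by positivity), Real.sqrt_mul (by positivity) ((ε : ℝ) * ε),
        Real.sqrt_mul_self ε.coe_nonneg]
    have hfin := mul_le_mul_of_nonneg_left hsq h₁
    simp only [NNReal.coe_add, NNReal.coe_mul, NNReal.coe_rpow, ← Real.sqrt_eq_rpow, coe_nnnorm,
      Real.coe_toNNReal _ hR₁, Real.coe_toNNReal (C₁ * √((1 + Z) * ‖x‖)) (by positivity)]
    simp only [R₁]
    linarith

/-! ### Growth of f relative to a slope -/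

namespace StandingAssumption

/-- Along a direction `d`, a function that is bounded below by an affine function of slope `v`
either has recession slope `v`, or grows at least linearly relative to that slope. -/
theorem recession_or_coercive (hf : StandingAssumption f) {v β d : ℝ} (hd : d * d = 1)
    (hβ : ∀ w ∈ dom f, v * w - β ≤ realPart f w) :
    (∀ l : ℝ, 0 ≤ l → !₂[l * d, 0, v * (l * d)] ∈ perspectiveCone f) ∨
      ∃ κ : ℝ, 0 < κ ∧ ∃ C : ℝ, ∀ w ∈ dom f, (v + κ * d) * w - C ≤ realPart f w := by
  by_cases H : ∀ w ∈ dom f, ∀ l : ℝ, 0 < l →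
      w + l * d ∈ dom f ∧ realPart f (w + l * d) ≤ realPart f w + v * (l * d)
  · left
    intro l hl
    rw [hf.mem_of_eq_zero (by simp)]
    intro w hw t ht
    rcases hl.eq_or_lt with rfl | hl
    · simp [hw]
    · obtain ⟨h1, h2⟩ := H w hw (t * l) (mul_pos ht hl)
      have e : t * l * d = t * (l * d) := by ring
      rw [e] at h1 h2
      refine ⟨by simpa using h1, ?_⟩
      simp only [Matrix.cons_val_zero, Matrix.cons_val]
      linarith
  · right
    push Not at H
    obtain ⟨w₁, hw₁, l, hl, H⟩ := H
    have hrep : ∀ w : ℝ, w = w₁ + d * (w - w₁) * d := fun w => by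
      linear_combination (w₁ - w) * hd
    have hconv : ∀ w ∈ dom f, l ≤ d * (w - w₁) → w₁ + l * d ∈ dom f ∧
        realPart f (w₁ + l * d) ≤ (1 - l / (d * (w - w₁))) * realPart f w₁ +
          l / (d * (w - w₁)) * realPart f w := by
      intro w hw hlw
      set μ := d * (w - w₁) with hμ
      have hμ0 : 0 < μ := hl.trans_le hlw
      have hle : l / μ ≤ 1 := (div_le_one hμ0).2 hlw
      have e : w₁ + l * d = (1 - l / μ) • w₁ + (l / μ) • w := by
        have h1 := hrep w
        rw [← hμ] at h1
        have h2 : l / μ * μ = l := div_mul_cancel₀ _ hμ0.ne'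
        simp only [smul_eq_mul]
        linear_combination (-(l / μ)) * h1 - d * h2
      rw [e]
      exact ⟨hf.convexOn.1 hw₁ hw (by linarith) (by positivity) (by ring),
        hf.convexOn.2 hw₁ hw (by linarith) (by positivity) (by ring)⟩
    by_cases hw₂ : w₁ + l * d ∈ dom f
    · have H := H hw₂
      set s := (realPart f (w₁ + l * d) - realPart f w₁ - v * (l * d)) / l with hs
      have hs0 : 0 < s := div_pos (by linarith) hl
      have hsl : s * l = realPart f (w₁ + l * d) - realPart f w₁ - v * (l * d) :=
        div_mul_cancel₀ _ hl.ne'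
      refine ⟨s, hs0, s * d * w₁ + s * l + |β| + |realPart f w₁ - v * w₁|, fun w hw => ?_⟩
      have hβ' := le_abs_self β
      have hF := neg_abs_le (realPart f w₁ - v * w₁)
      have hF0 := abs_nonneg (realPart f w₁ - v * w₁)
      have hβ0 := abs_nonneg β
      have hsl0 : 0 < s * l := by positivity
      rcases lt_or_ge (d * (w - w₁)) l with hlt | hge
      · have := hβ w hw
        have h1 := mul_lt_mul_of_pos_left hlt hs0
        linarith
      · obtain ⟨-, h2⟩ := hconv w hw hge
        have h3 := hrep w
        set μ := d * (w - w₁) with hμ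
        have hμ0 : 0 < μ := hl.trans_le hge
        have h5 := mul_le_mul_of_nonneg_left h2 (hμ0.le)
        have h6 : μ * ((1 - l / μ) * realPart f w₁ + l / μ * realPart f w) =
          (μ - l) * realPart f w₁ + l * realPart f w := by field_simp
        rw [h6] at h5
        have h7 : l * (realPart f w₁ + v * (μ * d) + s * μ) ≤ l * realPart f w := by
          linear_combination h5 + μ * hsl
        have h8 := le_of_mul_le_mul_left h7 hl
        have h9 : v * w = v * w₁ + v * (μ * d) := by linear_combination v * h3
        have h10 : s * μ = s * d * w - s * d * w₁ := by rw [hμ]; ring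
        linarith
    · refine ⟨1, one_pos, d * w₁ + l + β, fun w hw => ?_⟩
      have hlt : d * (w - w₁) < l := by
        by_contra! hge
        exact hw₂ (hconv w hw hge).1
      have := hβ w hw
      linarith

/-- Local strong convexity around a minimizer of `f - v` improves the supporting line at `u` to a
family of supporting lines. -/
theorem exists_growth (hf : StandingAssumption f) {u v δ m : ℝ} (hδ : 0 < δ) (hm : 0 < m)
    (hdom : Icc (u - δ) (u + δ) ⊆ dom f)
    (hsc : StrongConvexOn (Icc (u - δ) (u + δ)) m (realPart f))
    (hv : ∀ w ∈ dom f, realPart f u + v * (w - u) ≤ realPart f w) {s : ℝ}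
    (hsδ : 2 * s ≤ δ) : ∀ w ∈ dom f,
      realPart f u + v * (w - u) + m / 4 * (2 * s * |w - u| - s ^ 2) ≤ realPart f w := by
  have hu : u ∈ Icc (u - δ) (u + δ) := ⟨by linarith, by linarith⟩
  -- Strong convexity bounds f at the midpoint of u and w from above and the supporting line bounds
  -- it from below; doubling the difference m / 8 gives m / 4.
  have near : ∀ w ∈ Icc (u - δ) (u + δ),
      realPart f u + v * (w - u) + m / 4 * (w - u) ^ 2 ≤ realPart f w := by
    intro w hw
    have h1 := hsc.2 hu hw (by norm_num : (0 : ℝ) ≤ 1 / 2) (by norm_num : (0 : ℝ) ≤ 1 / 2)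
      (by norm_num)
    have h2 := hv _ (hdom (hsc.1 hu hw (by norm_num : (0 : ℝ) ≤ 1 / 2)
      (by norm_num : (0 : ℝ) ≤ 1 / 2) (by norm_num)))
    simp only [smul_eq_mul, Real.norm_eq_abs, sq_abs] at h1 h2
    linarith
  intro w hw
  rcases le_or_gt |w - u| δ with hle | hgt
  · have hw' : w ∈ Icc (u - δ) (u + δ) := by
      rw [abs_le] at hle; constructor <;> linarith
    have h1 := near w hw'
    have h2 := mul_nonneg hm.le (sq_nonneg (|w - u| - s))
    have h3 := sq_abs (w - u)
    linear_combination h1 + h2 / 4 + m / 4 * h3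
  -- Beyond distance δ, the quadratic growth reached at distance δ propagates linearly by convexity,
  -- with slope m / 4 * δ ≥ m / 4 * (2 * s).
  · have hq : 0 < |w - u| := hδ.trans hgt
    set l := δ / |w - u| with hl
    have hlq : l * |w - u| = δ := div_mul_cancel₀ _ hq.ne'
    have hl0 : 0 < l := div_pos hδ hq
    have hl1 : l ≤ 1 := (div_le_one hq).2 hgt.le
    have hmem : (1 - l) • u + l • w ∈ Icc (u - δ) (u + δ) := by
      have : |l * (w - u)| ≤ δ := by rw [abs_mul, abs_of_pos hl0, hlq]
      rw [abs_le] at this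
      simp only [smul_eq_mul]
      constructor <;> linarith
    have h1 := near _ hmem
    have h2 := hf.convexOn.2 (hdom hu) hw (by linarith : 0 ≤ 1 - l) hl0.le (by ring)
    simp only [smul_eq_mul] at h1 h2
    have h3 : ((1 - l) * u + l * w - u) ^ 2 = l * (δ * |w - u|) := by
      rw [show (1 - l) * u + l * w - u = l * (w - u) by ring, mul_pow, ← sq_abs (w - u)]
      linear_combination l * |w - u| * hlq
    rw [h3] at h1
    have h4 : l * (realPart f u + v * (w - u) + m / 4 * (δ * |w - u|)) ≤ l * realPart f w := by
      linarith
    have h5 := le_of_mul_le_mul_left h4 hl0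
    have h6 := mul_le_mul_of_nonneg_right hsδ hq.le
    have h7 : m / 4 * (2 * s * |w - u| - s ^ 2) ≤ m / 4 * (δ * |w - u|) := by
      have := sq_nonneg s
      gcongr
      linarith
    linarith

/-! ### The range of the derivative -/

theorem convexOn_interior (hf : StandingAssumption f) :
    ConvexOn ℝ (interior (dom f)) (realPart f) :=
  hf.convexOn.subset interior_subset hf.convexOn.1.interior

theorem hasDerivAt (hf : StandingAssumption f) {u : ℝ} (hu : u ∈ interior (dom f)) :
    HasDerivAt (realPart f) (deriv (realPart f) u) u :=
  ((hf.essentiallySmooth.differentiableOn u hu).differentiableAt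
    (isOpen_interior.mem_nhds hu)).hasDerivAt

theorem deriv_mono (hf : StandingAssumption f) {u w : ℝ} (hu : u ∈ interior (dom f))
    (hw : w ∈ interior (dom f)) (huw : u ≤ w) :
    deriv (realPart f) u ≤ deriv (realPart f) w := by
  rcases huw.eq_or_lt with rfl | huw
  · exact le_rfl
  · exact (hf.convexOn_interior.le_slope_of_hasDerivAt hu hw huw (hf.hasDerivAt hu)).trans
      (hf.convexOn_interior.slope_le_of_hasDerivAt hu hw huw (hf.hasDerivAt hw))

theorem tangent_le (hf : StandingAssumption f) {u w : ℝ} (hu : u ∈ interior (dom f))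
    (hw : w ∈ dom f) :
    realPart f u + deriv (realPart f) u * (w - u) ≤ realPart f w := by
  rcases lt_trichotomy u w with h | rfl | h
  · have := hf.convexOn.le_slope_of_hasDerivAt (interior_subset hu) hw h (hf.hasDerivAt hu)
    rw [slope_def_field, le_div_iff₀ (by linarith)] at this
    linarith
  · simp
  · have := hf.convexOn.slope_le_of_hasDerivAt hw (interior_subset hu) h (hf.hasDerivAt hu)
    rw [slope_def_field, div_le_iff₀ (by linarith)] at this
    linarith

/-- The derivative is unbounded near every boundary point of the domain. -/
theorem not_bounded_near_frontier (hf : StandingAssumption f) {e M : ℝ} {U : Set ℝ}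
    (he : e ∈ closure (interior (dom f))) (he' : e ∉ interior (dom f)) (hU : U ∈ 𝓝 e)
    (hM : ∀ w ∈ interior (dom f), w ∈ U → |deriv (realPart f) w| ≤ M) : False := by
  obtain ⟨x, hx, hlim⟩ := mem_closure_iff_seq_limit.1 he
  have ht := hf.essentiallySmooth.tendsto_abs_deriv x e hx
    ⟨closure_mono interior_subset he, he'⟩ hlim
  obtain ⟨k, hk, hk'⟩ := ((hlim.eventually_mem hU).and (ht.eventually_gt_atTop M)).exists
  exact absurd (hM _ (hx k) hk) (not_le.2 hk')

/-- If f' < v throughout, the tangent at w evaluated at w₀ gives f growth of slope at most v, so the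
coercive minorant bounds the domain above. Near its right end f' is then trapped between f'(w₀) and
v, against essential smoothness. -/
theorem exists_le_deriv (hf : StandingAssumption f) {v κ C : ℝ} (hκ : 0 < κ)
    (h : ∀ w ∈ dom f, (v + κ * 1) * w - C ≤ realPart f w) :
    ∃ w ∈ interior (dom f), v ≤ deriv (realPart f) w := by
  by_contra! hlt
  obtain ⟨w₀, hw₀⟩ := hf.essentiallySmooth.nonempty_interior
  have hbdd : BddAbove (interior (dom f)) := by
    refine ⟨(C + realPart f w₀ - v * w₀) / κ + |w₀|, fun w hw => ?_⟩
    have h1 := h w (interior_subset hw)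
    rcases le_or_gt w w₀ with hle | hgt
    · have h3 := h w₀ (interior_subset hw₀)
      have h2 : w₀ ≤ (C + realPart f w₀ - v * w₀) / κ := by
        rw [le_div_iff₀ hκ]; linarith
      have := abs_nonneg w₀
      linarith
    · have h2 := (hf.tangent_le hw (interior_subset hw₀))
      have h4 := mul_pos (sub_pos.2 (hlt w hw)) (sub_pos.2 hgt)
      have h3 : w ≤ (C + realPart f w₀ - v * w₀) / κ := by
        rw [le_div_iff₀ hκ]; linarith
      have := abs_nonneg w₀
      linarith
  have hlub := isLUB_csSup ⟨w₀, hw₀⟩ hbdd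
  set e := sSup (interior (dom f))
  have he' : e ∉ interior (dom f) := by
    intro hmem
    obtain ⟨ε, hε, hball⟩ := Metric.isOpen_iff.1 isOpen_interior e hmem
    have : e + ε / 2 ∈ interior (dom f) := hball (by
      rw [Metric.mem_ball, Real.dist_eq, add_sub_cancel_left, abs_of_pos] <;> linarith)
    linarith [hlub.1 this]
  have hw₀e : w₀ < e := lt_of_le_of_ne (hlub.1 hw₀) fun h => he' (h ▸ hw₀)
  refine hf.not_bounded_near_frontier (M := max |v| |deriv (realPart f) w₀|)
    (hlub.mem_closure ⟨w₀, hw₀⟩) he' (Ioi_mem_nhds hw₀e) fun w hw hw' => ?_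
  exact abs_le_max_abs_abs (hf.deriv_mono hw₀ hw (le_of_lt hw')) (hlt w hw).le |>.trans
    (max_comm _ _).le

theorem exists_deriv_le (hf : StandingAssumption f) {v κ C : ℝ} (hκ : 0 < κ)
    (h : ∀ w ∈ dom f, (v + κ * -1) * w - C ≤ realPart f w) :
    ∃ w ∈ interior (dom f), deriv (realPart f) w ≤ v := by
  by_contra! hlt
  obtain ⟨w₀, hw₀⟩ := hf.essentiallySmooth.nonempty_interior
  have hbdd : BddBelow (interior (dom f)) := by
    refine ⟨-((C + realPart f w₀ - v * w₀) / κ + |w₀|), fun w hw => ?_⟩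
    have h1 := h w (interior_subset hw)
    rcases le_or_gt w₀ w with hle | hgt
    · have h3 := h w₀ (interior_subset hw₀)
      have h2 : -w₀ ≤ (C + realPart f w₀ - v * w₀) / κ := by
        rw [le_div_iff₀ hκ]; linarith
      have := abs_nonneg w₀
      linarith
    · have h2 := (hf.tangent_le hw (interior_subset hw₀))
      have h4 := mul_pos (sub_pos.2 (hlt w hw)) (sub_pos.2 hgt)
      have h3 : -w ≤ (C + realPart f w₀ - v * w₀) / κ := by
        rw [le_div_iff₀ hκ]; linarith
      have := abs_nonneg w₀
      linarith
  have hglb := isGLB_csInf ⟨w₀, hw₀⟩ hbdd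
  set e := sInf (interior (dom f))
  have he' : e ∉ interior (dom f) := by
    intro hmem
    obtain ⟨ε, hε, hball⟩ := Metric.isOpen_iff.1 isOpen_interior e hmem
    have : e - ε / 2 ∈ interior (dom f) := hball (by
      rw [Metric.mem_ball, Real.dist_eq, sub_sub_cancel_left, abs_neg, abs_of_pos] <;> linarith)
    linarith [hglb.1 this]
  have hw₀e : e < w₀ := lt_of_le_of_ne (hglb.1 hw₀) fun h => he' (h ▸ hw₀)
  refine hf.not_bounded_near_frontier (M := max |v| |deriv (realPart f) w₀|)
    (hglb.mem_closure ⟨w₀, hw₀⟩) he' (Iio_mem_nhds hw₀e) fun w hw hw' => ?_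
  exact abs_le_max_abs_abs (hlt w hw).le (hf.deriv_mono hw hw₀ (le_of_lt hw'))

theorem exists_deriv_eq (hf : StandingAssumption f) {v a b : ℝ}
    (ha : a ∈ interior (dom f)) (hav : deriv (realPart f) a ≤ v)
    (hb : b ∈ interior (dom f)) (hbv : v ≤ deriv (realPart f) b) :
    ∃ u ∈ interior (dom f), deriv (realPart f) u = v := by
  by_contra! hne
  rcases hasDerivWithinAt_forall_lt_or_forall_gt_of_forall_ne hf.convexOn_interior.1
    (fun x hx => (hf.hasDerivAt hx).hasDerivWithinAt) hne with h | h
  · linarith [h b hb]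
  · linarith [h a ha]

end StandingAssumption

/-! ### Conjugate and exceptional slopes -/

/-- The conjugate function `f*(v) = sup {v w - f w}`, for slopes `v` where it is finite. -/
noncomputable def conjugate (f : ℝ → EReal) (v : ℝ) : ℝ :=
  sSup ((fun w => v * w - realPart f w) '' dom f)

/-- The slopes `v` of affine minorants of `f` for which `f` has recession slope `v` along the
direction `d`. -/
def recessionSlopes (f : ℝ → EReal) (d : ℝ) : Set ℝ :=
  {v | (∃ β, ∀ w ∈ dom f, v * w - β ≤ realPart f w) ∧ !₂[d, 0, v * d] ∈ perspectiveCone f}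

theorem hausdorffMeasure_line_eq_zero {E : Type*} [NormedAddCommGroup E] [NormedSpace ℝ E]
    [MeasurableSpace E] [BorelSpace E] {s : ℝ} (hs : 1 < s) (p : E) :
    (Measure.hausdorffMeasure s : Measure E) (range fun l : ℝ => l • p) = 0 := by
  lift s to ℝ≥0 using by linarith
  refine hausdorffMeasure_of_dimH_lt ?_
  have h1 : LipschitzWith ‖p‖₊ fun l : ℝ => l • p :=
    LipschitzWith.of_dist_le_mul fun x y => by
      rw [dist_eq_norm, ← sub_smul, norm_smul, mul_comm, dist_eq_norm, coe_nnnorm]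
  have h2 := h1.dimH_range_le
  rw [Real.dimH_univ] at h2
  exact h2.trans_lt (by exact_mod_cast hs)

namespace StandingAssumption

theorem conjugate_le (hf : StandingAssumption f) {v β : ℝ}
    (h : ∀ w ∈ dom f, v * w - β ≤ realPart f w) : conjugate f v ≤ β := by
  refine csSup_le (hf.proper.2.image _) ?_
  rintro _ ⟨w, hw, rfl⟩
  have := h w hw
  dsimp only
  linarith

/-- The minorant with constant β bounds the set defining `conjugate f v` above, so its `sSup` is a
true supremum. -/
theorem sub_conjugate_le {v β : ℝ} (h : ∀ w ∈ dom f, v * w - β ≤ realPart f w) {w : ℝ}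
    (hw : w ∈ dom f) : v * w - conjugate f v ≤ realPart f w := by
  have : v * w - realPart f w ≤ conjugate f v := by
    refine le_csSup ⟨β, ?_⟩ ⟨w, hw, rfl⟩
    rintro _ ⟨x, hx, rfl⟩
    have := h x hx
    dsimp only
    linarith
  linarith

/-- The slope of any affine minorant, taken along d, is at most the recession slope along d; two
recession slopes thus bound each other. -/
theorem subsingleton_recessionSlopes (hf : StandingAssumption f) {d : ℝ} (hd : d * d = 1) :
    (recessionSlopes f d).Subsingleton := by
  have key : ∀ v ∈ recessionSlopes f d, ∀ v' ∈ recessionSlopes f d, v * d ≤ v' * d := by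
    rintro v ⟨⟨β, hβ⟩, -⟩ v' ⟨-, hv'⟩
    simpa using hf.le_of_affine_le hβ hv'
  intro v hv v' hv'
  have h := le_antisymm (key v hv v' hv') (key v' hv' v hv)
  linear_combination d * h - (v - v') * hd

/-- Slopes of affine minorants without recession in either direction are attained by `f'`. -/
theorem exists_deriv_eq_of_notMem (hf : StandingAssumption f) {v β : ℝ}
    (hβ : ∀ w ∈ dom f, v * w - β ≤ realPart f w) (h₁ : v ∉ recessionSlopes f 1)
    (h₂ : v ∉ recessionSlopes f (-1)) :
    ∃ u ∈ interior (dom f), deriv (realPart f) u = v := by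
  rcases hf.recession_or_coercive (d := 1) (by norm_num) hβ with h | ⟨κ, hκ, C, hC⟩
  · exact absurd ⟨⟨β, hβ⟩, by simpa using h 1 zero_le_one⟩ h₁
  rcases hf.recession_or_coercive (d := -1) (by norm_num) hβ with h | ⟨κ', hκ', C', hC'⟩
  · exact absurd ⟨⟨β, hβ⟩, by simpa using h 1 zero_le_one⟩ h₂
  obtain ⟨b, hb, hbv⟩ := hf.exists_le_deriv hκ hC
  obtain ⟨a, ha, hav⟩ := hf.exists_deriv_le hκ' hC'
  exact hf.exists_deriv_eq ha hav hb hbv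

/-! ### Error bounds for the three kinds of functionals -/

/-- A linear error bound for functionals vanishing on the vertical direction. -/
theorem admits_of_vertical (hf : StandingAssumption f) {z : EuclideanSpace ℝ (Fin 3)} {e : ℝ}
    (hz₂ : z 2 = 0) (hz₀ : z 0 ≠ 0) (he : ∀ w ∈ dom f, 0 ≤ z 0 * (w - e))
    (hpos : 0 < z 0 * e + z 1) : AdmitsHolderianOneFRF (perspectiveCone f) z (1 / 2) := by
  have ha : 0 < |z 0| := abs_pos.2 hz₀
  refine admitsHolderianOneFRF_of_bound (C₀ := 1 / |z 0| + (1 + |e|) / (z 0 * e + z 1)) (C₁ := 0)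
    hf.nonempty_perspectiveCone (by positivity) le_rfl fun y hy => ?_
  have ht := nonneg_of_mem hy
  have hx : 0 ≤ z 0 * (y 0 - e * y 1) := by
    by_contra! hlt
    -- Since f ≥ 0 and z 0 * (w - e) ≥ 0 on dom f, every -N * z 0 * (w - e) is an affine minorant;
    -- large N gives a contradiction.
    have hN : ∀ N : ℝ, 0 ≤ N → N * -(z 0 * (y 0 - e * y 1)) ≤ y 2 := fun N hN => by
      have := hf.le_of_affine_le (p := -(N * z 0)) (q := -(N * z 0 * e)) (fun w hw => by
        have h1 := mul_nonneg hN (he w hw)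
        have h2 := hf.realPart_nonneg w
        linarith) hy
      linarith
    have hd : 0 < -(z 0 * (y 0 - e * y 1)) := by linarith
    have h0 := hN 0 le_rfl
    have h1 := hN ((y 2 + 1) / -(z 0 * (y 0 - e * y 1))) (div_nonneg (by linarith) hd.le)
    rw [div_mul_cancel₀ _ hd.ne'] at h1
    linarith
  have hr : 0 ≤ y 2 := by
    have := hf.le_of_affine_le (p := 0) (q := 0) (fun w _ => by
      simpa using hf.realPart_nonneg w) hy
    linarith
  have hmem : !₂[0, 0, y 2] ∈ exposedFace (perspectiveCone f) z :=
    ⟨hf.mem_vertical hr, by simp [inner_eq, hz₂]⟩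
  refine (Metric.infDist_le_dist_of_mem hmem).trans ((dist_le_sum _ _).trans ?_)
  simp only [inner_eq, hz₂, Matrix.cons_val_zero, Matrix.cons_val, Matrix.cons_val_one, sub_zero,
    sub_self, abs_zero, zero_mul, add_zero, mul_zero]
  set P := y 0 * z 0 + y 1 * z 1 with hP
  have hP' : P = z 0 * (y 0 - e * y 1) + (z 0 * e + z 1) * y 1 := by rw [hP]; ring
  have h1 : |y 0 - e * y 1| ≤ P / |z 0| := by
    rw [le_div_iff₀ ha, ← abs_mul, mul_comm, abs_of_nonneg hx]
    have := mul_nonneg hpos.le ht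
    linarith
  have h2 : y 1 ≤ P / (z 0 * e + z 1) := by
    rw [le_div_iff₀ hpos]; linarith
  have h3 : |y 0| ≤ |y 0 - e * y 1| + |e| * y 1 := by
    have := abs_add_le (y 0 - e * y 1) (e * y 1)
    rwa [abs_mul, abs_of_nonneg ht, sub_add_cancel] at this
  have h4 := mul_le_mul_of_nonneg_left h2 (by positivity : 0 ≤ 1 + |e|)
  rw [abs_of_nonneg ht]
  calc |y 0| + y 1 ≤ P / |z 0| + (1 + |e|) * (P / (z 0 * e + z 1)) := by linarith
    _ = _ := by ring

/-- The error bound on one of the halves `± x ≥ 0` for functionals strictly above the graph of the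
conjugate function. -/
theorem exists_bound_of_conjugate_lt (hf : StandingAssumption f) {z : EuclideanSpace ℝ (Fin 3)}
    {v β γ d : ℝ} (hd : d * d = 1) (hc : 0 < z 2) (hz₀ : z 0 = -(v * z 2)) (hz₁ : z 1 = β * z 2)
    (hγ : ∀ w ∈ dom f, v * w - γ ≤ realPart f w) (hγβ : γ < β) :
    ∃ C₀ : ℝ, 0 ≤ C₀ ∧ ∀ y ∈ perspectiveCone f, |y 0| = d * y 0 →
      Metric.infDist y (exposedFace (perspectiveCone f) z) ≤ C₀ * inner ℝ y z := by
  have hτ : 0 < β - γ := sub_pos.2 hγβ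
  have hinner : ∀ y : EuclideanSpace ℝ (Fin 3),
      inner ℝ y z = z 2 * (y 2 - v * y 0 + β * y 1) := fun y => by
    rw [inner_eq, hz₀, hz₁]; ring
  have hQ : ∀ y ∈ perspectiveCone f, y 1 ≤ (y 2 - v * y 0 + β * y 1) / (β - γ) ∧
      0 ≤ y 2 - v * y 0 + β * y 1 := fun y hy => by
    have h1 := hf.le_of_affine_le hγ hy
    have h2 := mul_nonneg hτ.le (nonneg_of_mem hy)
    refine ⟨?_, by linarith⟩
    rw [le_div_iff₀ hτ]
    linarith
  -- With recession slope v, y is compared with (y 0, 0, v * y 0) in the face; otherwise coercivity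
  -- bounds |y 0| too and the origin suffices.
  rcases hf.recession_or_coercive hd hγ with h | ⟨κ, hκ, C, hC⟩
  · refine ⟨(1 + (1 + |β|) / (β - γ)) / z 2, by positivity, fun y hy hyd => ?_⟩
    have hmem : !₂[y 0, 0, v * y 0] ∈ exposedFace (perspectiveCone f) z := by
      refine ⟨?_, by simp [hinner]⟩
      have := h |y 0| (abs_nonneg _)
      rwa [show |y 0| * d = y 0 by rw [hyd]; linear_combination y 0 * hd] at this
    refine (Metric.infDist_le_dist_of_mem hmem).trans ((dist_le_sum _ _).trans ?_)
    simp only [hinner, Matrix.cons_val_zero, Matrix.cons_val, Matrix.cons_val_one, sub_zero,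
      sub_self, abs_zero, zero_add]
    obtain ⟨h1, h2⟩ := hQ y hy
    have ht := nonneg_of_mem hy
    set Q := y 2 - v * y 0 + β * y 1 with hQ'
    have h3 : |y 2 - v * y 0| ≤ Q + |β| * y 1 := by
      have := abs_sub Q (β * y 1)
      rw [abs_mul, abs_of_nonneg ht, abs_of_nonneg h2] at this
      rwa [show y 2 - v * y 0 = Q - β * y 1 by rw [hQ']; ring]
    have h4 := mul_le_mul_of_nonneg_left h1 (by positivity : 0 ≤ 1 + |β|)
    rw [abs_of_nonneg ht]
    calc y 1 + |y 2 - v * y 0| ≤ Q + (1 + |β|) * (Q / (β - γ)) := by linarith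
      _ = _ := by field_simp
  · set B := (1 + (|C| + |β|) / (β - γ)) / κ with hB
    have hB0 : 0 ≤ B := by positivity
    refine ⟨((1 + |v|) * B + (1 + (1 + |β|) / (β - γ))) / z 2, by positivity, fun y hy hyd => ?_⟩
    have hmem : !₂[0, 0, 0] ∈ exposedFace (perspectiveCone f) z :=
      ⟨hf.mem_vertical le_rfl, by simp [hinner]⟩
    refine (Metric.infDist_le_dist_of_mem hmem).trans ((dist_le_sum _ _).trans ?_)
    simp only [hinner, Matrix.cons_val_zero, Matrix.cons_val, Matrix.cons_val_one, sub_zero]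
    obtain ⟨h1, h2⟩ := hQ y hy
    have ht := nonneg_of_mem hy
    have h5 := hf.le_of_affine_le hC hy
    set Q := y 2 - v * y 0 + β * y 1 with hQ'
    have h6 : |y 0| ≤ B * Q := by
      have e : B * Q = (Q + (|C| + |β|) * (Q / (β - γ))) / κ := by rw [hB]; field_simp
      rw [e, le_div_iff₀ hκ, hyd]
      have h7 := mul_le_mul_of_nonneg_left h1 (by positivity : 0 ≤ |C| + |β|)
      have h8 := mul_le_mul_of_nonneg_right (le_abs_self C) ht
      have h9 := mul_le_mul_of_nonneg_right (neg_abs_le β) ht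
      linarith
    have h3 : |y 2| ≤ Q + |v| * |y 0| + |β| * y 1 := by
      have h7 := abs_add_le (Q + v * y 0) (-(β * y 1))
      have h8 := abs_add_le Q (v * y 0)
      rw [abs_neg, abs_mul, abs_of_nonneg ht] at h7
      rw [abs_mul, abs_of_nonneg h2] at h8
      rw [show y 2 = Q + v * y 0 + -(β * y 1) by rw [hQ']; ring]
      linarith
    have h4 := mul_le_mul_of_nonneg_left h1 (by positivity : 0 ≤ 1 + |β|)
    have h9 := mul_le_mul_of_nonneg_left h6 (by positivity : 0 ≤ 1 + |v|)
    rw [abs_of_nonneg ht]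
    calc |y 0| + y 1 + |y 2| ≤ (1 + |v|) * (B * Q) + (Q + (1 + |β|) * (Q / (β - γ))) := by linarith
      _ = _ := by field_simp

theorem admits_of_conjugate_lt (hf : StandingAssumption f) {z : EuclideanSpace ℝ (Fin 3)}
    {v β γ : ℝ} (hc : 0 < z 2) (hz₀ : z 0 = -(v * z 2)) (hz₁ : z 1 = β * z 2)
    (hγ : ∀ w ∈ dom f, v * w - γ ≤ realPart f w) (hγβ : γ < β)
    (hz : ∀ y ∈ perspectiveCone f, 0 ≤ inner ℝ y z) :
    AdmitsHolderianOneFRF (perspectiveCone f) z (1 / 2) := by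
  obtain ⟨A, hA, hA'⟩ := hf.exists_bound_of_conjugate_lt (d := 1) (by norm_num) hc hz₀ hz₁ hγ hγβ
  obtain ⟨B, hB, hB'⟩ := hf.exists_bound_of_conjugate_lt (d := -1) (by norm_num) hc hz₀ hz₁ hγ hγβ
  refine admitsHolderianOneFRF_of_bound (C₀ := A + B) (C₁ := 0)
    hf.nonempty_perspectiveCone (by positivity) le_rfl fun y hy => ?_
  have h1 := mul_nonneg hA (hz y hy)
  have h2 := mul_nonneg hB (hz y hy)
  rcases abs_cases (y 0) with h | h
  · have := hA' y hy (by rw [h.1]; ring)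
    linarith
  · have := hB' y hy (by rw [h.1]; ring)
    linarith

/-- The square-root error bound at a functional supporting the graph of `f` at a point of local
strong convexity. -/
theorem admits_of_tangent (hf : StandingAssumption f) {z : EuclideanSpace ℝ (Fin 3)}
    {u v κ δ : ℝ} (hu : u ∈ dom f) (hc : 0 < z 2) (hz₀ : z 0 = -(v * z 2))
    (hz₁ : z 1 = (v * u - realPart f u) * z 2) (hκ : 0 < κ) (hδ : 0 < δ)
    (hgrowth : ∀ s : ℝ, 0 ≤ s → 2 * s ≤ δ → ∀ w ∈ dom f,
      realPart f u + v * (w - u) + κ * (2 * s * |w - u| - s ^ 2) ≤ realPart f w) :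
    AdmitsHolderianOneFRF (perspectiveCone f) z (1 / 2) := by
  refine admitsHolderianOneFRF_of_bound
    (C₀ := ((1 + |v|) * (2 / (κ * δ)) + 1) / z 2) (C₁ := (1 + |v|) * √(1 / (z 2 * κ)))
    hf.nonempty_perspectiveCone (by positivity) (by positivity) fun y hy => ?_
  have ht := nonneg_of_mem hy
  have hinner : ∀ y : EuclideanSpace ℝ (Fin 3), inner ℝ y z =
      z 2 * (y 2 - realPart f u * y 1 - v * (y 0 - u * y 1)) := fun y => by
    rw [inner_eq, hz₀, hz₁]; ring
  have hmem : !₂[y 1 * u, y 1, y 1 * realPart f u] ∈ exposedFace (perspectiveCone f) z :=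
    ⟨hf.mem_of_dom hu ht, by rw [Set.mem_ofPred_eq, hinner]; simp; right; ring⟩
  refine (Metric.infDist_le_dist_of_mem hmem).trans ((dist_le_sum _ _).trans ?_)
  simp only [Matrix.cons_val_zero, Matrix.cons_val, Matrix.cons_val_one, sub_self, abs_zero,
    add_zero]
  have hQs : ∀ s : ℝ, 0 ≤ s → 2 * s ≤ δ → κ * (2 * s * |y 0 - u * y 1| - s ^ 2 * y 1) ≤
      y 2 - realPart f u * y 1 - v * (y 0 - u * y 1) := by
    -- Quadratic growth is replaced by its tangents, indexed by s; with the sign σ = ±1 each is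
    -- affine in w and so passes to the cone.
    have side : ∀ σ : ℝ, |σ| ≤ 1 → ∀ s : ℝ, 0 ≤ s → 2 * s ≤ δ →
        κ * (2 * s * (σ * (y 0 - u * y 1)) - s ^ 2 * y 1) ≤
        y 2 - realPart f u * y 1 - v * (y 0 - u * y 1) := by
      intro σ hσ s hs hsδ
      have := hf.le_of_affine_le (p := v + κ * (2 * s * σ))
        (q := -(realPart f u - v * u - κ * (2 * s * σ * u) - κ * s ^ 2)) (fun w hw => by
          have h1 := hgrowth s hs hsδ w hw
          have h2 : σ * (w - u) ≤ |w - u| := by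
            refine (le_abs_self _).trans ?_
            rw [abs_mul]
            exact mul_le_of_le_one_left (abs_nonneg _) hσ
          have h3 := mul_le_mul_of_nonneg_left h2 (by positivity : 0 ≤ κ * (2 * s))
          linarith) hy
      linarith
    intro s hs hsδ
    rcases abs_cases (y 0 - u * y 1) with h | h
    · have := side 1 (by simp) s hs hsδ
      rw [h.1]; linarith
    · have := side (-1) (by simp) s hs hsδ
      rw [h.1]; linarith
  have hy1 : y 1 ≤ ‖y‖ := (le_abs_self _).trans (by simpa using PiLp.norm_apply_le y 1)
  have hX0 := abs_nonneg (y 0 - u * y 1)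
  rw [hinner, mul_comm (y 1) u, mul_comm (y 1) (realPart f u)]
  have hQ0 := hQs 0 le_rfl (by linarith)
  set X := |y 0 - u * y 1| with hXdef
  set Q := y 2 - realPart f u * y 1 - v * (y 0 - u * y 1) with hQdef
  have hQ0 : 0 ≤ Q := by simpa using hQ0
  have hX : X ≤ 2 / (κ * δ) * Q + √(1 / (z 2 * κ)) * √(‖y‖ * (z 2 * Q)) := by
    rcases le_or_gt (2 * X) (δ * y 1) with hle | hgt
    · have hsq : X ≤ √(1 / (z 2 * κ)) * √(‖y‖ * (z 2 * Q)) := by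
        rw [← Real.sqrt_mul (by positivity)]
        apply Real.le_sqrt_of_sq_le
        rw [show 1 / (z 2 * κ) * (‖y‖ * (z 2 * Q)) = ‖y‖ * Q / κ by field_simp, le_div_iff₀ hκ]
        refine le_trans ?_ (mul_le_mul_of_nonneg_right hy1 hQ0)
        rcases ht.eq_or_lt with h0 | hpos
        · have : X = 0 := by rw [← h0] at hle; linarith
          simp [this, ← h0]
        -- The value s = X / y 1 maximises 2 * s * X - s ^ 2 * y 1. When it exceeds δ / 2, the cap s
        -- = δ / 2 gives the linear term.
        · have h1 := hQs (X / y 1) (by positivity) (by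
            rw [← mul_div_assoc, div_le_iff₀ hpos]; exact hle)
          have h2 := mul_le_mul_of_nonneg_left h1 ht
          have h3 : y 1 * (κ * (2 * (X / y 1) * X - (X / y 1) ^ 2 * y 1)) = X ^ 2 * κ := by
            field_simp; ring
          linarith
      have : 0 ≤ 2 / (κ * δ) * Q := by positivity
      linarith
    · have h1 := hQs (δ / 2) (by positivity) (by linarith)
      have h2 : X ≤ 2 / (κ * δ) * Q := by
        rw [div_mul_eq_mul_div, le_div_iff₀ (by positivity)]
        have h3 := mul_lt_mul_of_pos_left hgt (by positivity : 0 < κ * δ)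
        nlinarith
      have : 0 ≤ √(1 / (z 2 * κ)) * √(‖y‖ * (z 2 * Q)) := by positivity
      linarith
  have hr : |y 2 - realPart f u * y 1| ≤ Q + |v| * X := by
    have := abs_add_le Q (v * (y 0 - u * y 1))
    rw [abs_mul, abs_of_nonneg hQ0] at this
    rwa [show y 2 - realPart f u * y 1 = Q + v * (y 0 - u * y 1) by rw [hQdef]; ring]
  have h9 := mul_le_mul_of_nonneg_left hX (by positivity : 0 ≤ 1 + |v|)
  calc X + |y 2 - realPart f u * y 1|
      ≤ (1 + |v|) * (2 / (κ * δ) * Q + √(1 / (z 2 * κ)) * √(‖y‖ * (z 2 * Q))) + Q := by linarith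
    _ = _ := by field_simp; ring

end StandingAssumption

/-! ### Exceptional lines and the case distinction -/

/-- Generators of the countably many lines outside of which the error bound is established. -/
def exceptionalGenerators (f : ℝ → EReal) (W : Set ℝ) : Set (EuclideanSpace ℝ (Fin 3)) :=
  {!₂[0, 1, 0], !₂[1, -sInf (dom f), 0], !₂[1, -sSup (dom f), 0]} ∪
    (fun v => !₂[-v, conjugate f v, 1]) ''
      (deriv (realPart f) '' W ∪ recessionSlopes f 1 ∪ recessionSlopes f (-1))

namespace StandingAssumption

theorem countable_exceptionalGenerators (hf : StandingAssumption f) {W : Set ℝ} (hW : W.Finite) :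
    (exceptionalGenerators f W).Countable := by
  have h1 := (hf.subsingleton_recessionSlopes (d := 1) (by norm_num)).finite.countable
  have h2 := (hf.subsingleton_recessionSlopes (d := -1) (by norm_num)).finite.countable
  exact (Set.toFinite _).countable.union
    ((((hW.image _).countable.union h1).union h2).image _)

theorem admits_of_vertical_of_notMem (hf : StandingAssumption f) {W : Set ℝ}
    {z : EuclideanSpace ℝ (Fin 3)} (hz₂ : z 2 = 0) (hz : ∀ w ∈ dom f, 0 ≤ z 0 * w + z 1)
    (hne : ∀ p ∈ exceptionalGenerators f W, ∀ l : ℝ, l • p ≠ z) :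
    AdmitsHolderianOneFRF (perspectiveCone f) z (1 / 2) := by
  have hz₀ : z 0 ≠ 0 := fun h => hne !₂[0, 1, 0] (by simp [exceptionalGenerators]) (z 1) (by
    ext i; fin_cases i <;> simp [h, hz₂])
  have hline : ∀ e : ℝ, z 0 * e + z 1 = 0 → z 0 • !₂[1, -e, 0] = z := fun e he => by
    ext i
    fin_cases i
    · simp
    · simp; linarith
    · simp [hz₂]
  obtain ⟨w₀, hw₀⟩ := hf.proper.2
  rcases hz₀.lt_or_gt with ha | ha
  -- The sign of z 0 makes dom f bounded on the relevant side, so the default value of `sSup` or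
  -- `sInf` on an unbounded set plays no role.
  · have hb : ∀ w ∈ dom f, w ≤ -z 1 / z 0 := fun w hw => by
      rw [le_div_iff_of_neg ha]; linarith [hz w hw]
    have h1 := csSup_le ⟨w₀, hw₀⟩ hb
    rw [le_div_iff_of_neg ha] at h1
    refine hf.admits_of_vertical hz₂ hz₀ (e := sSup (dom f)) (fun w hw => ?_)
      (lt_of_le_of_ne (by linarith) fun h => ?_)
    · exact mul_nonneg_of_nonpos_of_nonpos ha.le (sub_nonpos.2 (le_csSup ⟨_, hb⟩ hw))
    · exact hne _ (by simp [exceptionalGenerators]) (z 0) (hline _ h.symm)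
  · have hb : ∀ w ∈ dom f, -z 1 / z 0 ≤ w := fun w hw => by
      rw [div_le_iff₀ ha]; linarith [hz w hw]
    have h1 := le_csInf ⟨w₀, hw₀⟩ hb
    rw [div_le_iff₀ ha] at h1
    refine hf.admits_of_vertical hz₂ hz₀ (e := sInf (dom f)) (fun w hw => ?_)
      (lt_of_le_of_ne (by linarith) fun h => ?_)
    · exact mul_nonneg ha.le (sub_nonneg.2 (csInf_le ⟨_, hb⟩ hw))
    · exact hne _ (by simp [exceptionalGenerators]) (z 0) (hline _ h.symm)

theorem admits_of_notMem (hf : StandingAssumption f) {W : Set ℝ} (hW : W.Finite)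
    (hsc : ∀ C : Set ℝ, IsCompact C → Convex ℝ C → C ⊆ interior (dom f) \ W →
      ∃ m : ℝ, 0 < m ∧ StrongConvexOn C m (realPart f))
    {z : EuclideanSpace ℝ (Fin 3)} (hz : z ∈ dualCone (perspectiveCone f))
    (hne : ∀ p ∈ exceptionalGenerators f W, ∀ l : ℝ, l • p ≠ z) :
    AdmitsHolderianOneFRF (perspectiveCone f) z (1 / 2) := by
  rw [mem_dualCone_iff] at hz
  have hc : 0 ≤ z 2 := by simpa [inner_eq] using hz _ (hf.mem_vertical zero_le_one)
  have hdom : ∀ w ∈ dom f, 0 ≤ w * z 0 + z 1 + realPart f w * z 2 := fun w hw => by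
    simpa [inner_eq] using hz _ (hf.mem_of_dom hw zero_le_one)
  rcases hc.eq_or_lt with hc | hc
  · refine hf.admits_of_vertical_of_notMem hc.symm (fun w hw => ?_) hne
    have := hdom w hw
    rw [← hc] at this
    linarith
  obtain ⟨v, hv⟩ : ∃ v, z 0 = -(v * z 2) := ⟨-z 0 / z 2, by field_simp⟩
  obtain ⟨β, hβ⟩ : ∃ β, z 1 = β * z 2 := ⟨z 1 / z 2, by field_simp⟩
  have hmin : ∀ w ∈ dom f, v * w - β ≤ realPart f w := fun w hw => by
    have h1 := hdom w hw
    rw [hv, hβ] at h1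
    refine le_of_mul_le_mul_right ?_ hc
    linarith
  rcases (hf.conjugate_le hmin).lt_or_eq with hlt | heq
  · exact hf.admits_of_conjugate_lt hc hv hβ (fun w hw => sub_conjugate_le hmin hw) hlt hz
  have hvV : v ∉ deriv (realPart f) '' W ∪ recessionSlopes f 1 ∪ recessionSlopes f (-1) :=
    fun hvV => hne _ (Or.inr ⟨v, hvV, rfl⟩) (z 2) (by
      ext i; fin_cases i <;> simp [hv, hβ, heq, mul_comm])
  simp only [mem_union, not_or] at hvV
  obtain ⟨u, hu, huv⟩ := hf.exists_deriv_eq_of_notMem hmin hvV.1.2 hvV.2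
  have huW : u ∉ W := fun h => hvV.1.1 ⟨u, h, huv⟩
  have htan : ∀ w ∈ dom f, realPart f u + v * (w - u) ≤ realPart f w := fun w hw =>
    huv ▸ hf.tangent_le hu hw
  -- The tangent at u attains the supremum f*(v) = β.
  have hβu : β = v * u - realPart f u := by
    refine le_antisymm ?_ (by linarith [hmin u (interior_subset hu)])
    rw [← heq]
    exact hf.conjugate_le fun w hw => by linarith [htan w hw]
  obtain ⟨δ, hδ, hball⟩ := Metric.nhds_basis_closedBall.mem_iff.1
    ((isOpen_interior.sdiff hW.isClosed).mem_nhds ⟨hu, huW⟩)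
  rw [Real.closedBall_eq_Icc] at hball
  obtain ⟨m, hm, hsc⟩ := hsc _ isCompact_Icc (convex_Icc _ _) hball
  exact hf.admits_of_tangent (interior_subset hu) hc hv (hβu ▸ hβ) (div_pos hm four_pos) hδ
    fun s _ hsδ => hf.exists_growth hδ hm
      (fun w hw => interior_subset (hball hw).1) hsc htan hsδ

end StandingAssumption

end PerspectiveCone

theorem mainTheorem1 (f : ℝ → EReal) (hf : PerspectiveCone.StandingAssumption f)
    (s : ℝ) (hs : 1 < s) :
    ∀ᵐ z ∂(Measure.hausdorffMeasure s : Measure (EuclideanSpace ℝ (Fin 3))),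
      z ∈ frontier (PerspectiveCone.dualCone (PerspectiveCone.perspectiveCone f)) →
        PerspectiveCone.AdmitsHolderianOneFRF (PerspectiveCone.perspectiveCone f) z (1 / 2) := by
  obtain ⟨W, hW, -, hsc, -⟩ := hf.exists_finite
  have hnull : (Measure.hausdorffMeasure s : Measure (EuclideanSpace ℝ (Fin 3)))
      (⋃ p ∈ PerspectiveCone.exceptionalGenerators f W, range fun l : ℝ => l • p) = 0 :=
    (measure_biUnion_null_iff (hf.countable_exceptionalGenerators hW)).2 fun p _ =>
      PerspectiveCone.hausdorffMeasure_line_eq_zero hs p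
  filter_upwards [measure_eq_zero_iff_ae_notMem.1 hnull] with z hz hzf
  refine hf.admits_of_notMem hW hsc
    ((PerspectiveCone.isClosed_dualCone _).frontier_subset hzf) fun p hp l hl => hz ?_
  exact mem_biUnion hp ⟨l, hl⟩
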